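/- Theorem 1 ($k$-NN regression rate). Let $D\ge 1$, let $\mathcal X\subseteq\mathbb R^D$ be compact and let $f:\mathcal X\to\mathbb R$ be any function (no continuity is assumed). For $x\in\mathcal X$ and $r\ge 0$ let $B(x,r)=\{x'\in\mathcal X:|x-x'|\le r\}$, and let $$u_f(x,r)=\sup_{x'\in B(x,r)}|f(x)-f(x')|\in[0,\infty].$$ Let $v_D$ be the volume of the unit ball of $\mathbb R^D$. Assume: (1) there are $\gamma>0$ and $r_0>0$ such that, for all $x\in\mathcal X$ and $0<r<r_0$, $\mathrm{Vol}(\mathcal X\cap\{x':|x-x'|\le r\})\ge\gamma\,\mathrm{Vol}(\{x'\in\mathbb R^D:|x-x'|\le r\})$; (2) $p_X$ is a probability density on $\mathbb R^D$ with $\{p_X\neq 0\}=\mathcal X$ and $p_{X,0}:=\inf_{x\in\mathcal X}p_X(x)>0$; (3) $\xi$ is a real random variable with $\mathbb E[\xi]=0$ and, for some $\sigma\ge 0$, $\mathbb E[e^{\lambda\xi}]\le e^{\sigma^2\lambda^2/2}$ for all $\lambda\in\mathbb R$. Let $x_1,\dots,x_n\in\mathcal X$ be i.i.d. with density $p_X$,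 let $\xi_1,\dots,\xi_n$ be i.i.d. copies of $\xi$, independent of $(x_1,\dots,x_n)$, and let $y_i=f(x_i)+\xi_i$. Put $X=\{x_1,\dots,x_n\}$ and, for an integer $k\ge 1$ and $x\in\mathcal X$, $$r_k(x)=\inf\{r:|B(x,r)\cap X|\ge k\},\qquad N_k(x)=B(x,r_k(x))\cap X,\qquad f_k(x)=\frac1{|N_k(x)|}\sum_{i=1}^n y_i\,\mathbf 1[x_i\in N_k(x)].$$ Let $0<\delta<1$. If $$2^8\,D\,\log^2(4/\delta)\,\log n\ \le\ k\ \le\ \tfrac12\,\gamma\,p_{X,0}\,v_D\,r_0^D\,n,$$ then, with probability at least $1-\delta$, for all $x\in\mathcal X$ simultaneously, $$|f(x)-f_k(x)|\ \le\ u_f\!\left(x,\Big(\frac{2k}{\gamma\,p_{X,0}\,v_D\,n}\Big)^{1/D}\right)+2\sigma\sqrt{\frac{D\log n+\log(2/\delta)}{k}}.$$ -/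

import Mathlib

open MeasureTheory ProbabilityTheory
open scoped ENNReal NNReal

namespace KNN

/-- Support regularity with constants `γ` and `r₀`: `Vol (𝒳 ∩ B(x, r)) ≥ γ * Vol (B(x, r))` for all
`x ∈ 𝒳` and `0 < r < r₀`, where `B(x, r)` is the closed Euclidean ball. -/
def SupportRegular {D : ℕ} (𝒳 : Set (EuclideanSpace ℝ (Fin D))) (γ r₀ : ℝ) : Prop :=
  0 < γ ∧ 0 < r₀ ∧ ∀ x ∈ 𝒳, ∀ r : ℝ, 0 < r → r < r₀ →
    ENNReal.ofReal γ * volume (Metric.closedBall x r) ≤ volume (𝒳 ∩ Metric.closedBall x r)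

/-- `p` is a probability density with support `𝒳`. -/
structure IsDensityWithSupport {D : ℕ} (p : EuclideanSpace ℝ (Fin D) → ℝ)
    (𝒳 : Set (EuclideanSpace ℝ (Fin D))) : Prop where
  measurable : Measurable p
  nonneg : ∀ x, 0 ≤ p x
  support_eq : Function.support p = 𝒳
  lintegral_eq_one : ∫⁻ x, ENNReal.ofReal (p x) = 1

/-- The probability measure with density `p`. -/
noncomputable def densityMeasure {D : ℕ} (p : EuclideanSpace ℝ (Fin D) → ℝ) :
    Measure (EuclideanSpace ℝ (Fin D)) :=
  volume.withDensity fun x => ENNReal.ofReal (p x)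

/-- `p_{X,0} = inf_{x ∈ 𝒳} p x`. -/
noncomputable def densityInf {D : ℕ} (p : EuclideanSpace ℝ (Fin D) → ℝ)
    (𝒳 : Set (EuclideanSpace ℝ (Fin D))) : ℝ :=
  sInf (p '' 𝒳)

/-- The law `ν` on `ℝ` has mean zero and is sub-Gaussian with parameter `σ ^ 2`, that is,
`E[exp (t ξ)] ≤ exp (σ ^ 2 * t ^ 2 / 2)` for all real `t`, with `exp (t ξ)` integrable. -/
def SubGaussianNoise (ν : Measure ℝ) (σ : ℝ≥0) : Prop :=
  ∫ z, z ∂ν = 0 ∧ HasSubgaussianMGF (fun z : ℝ => z) (σ ^ 2) ν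

/-- `v_D`, the volume of the unit ball of `ℝ^D`. -/
noncomputable def unitBallVolume (D : ℕ) : ℝ :=
  (volume (Metric.closedBall (0 : EuclideanSpace ℝ (Fin D)) 1)).toReal

section Estimator

variable {M : Type*} [PseudoMetricSpace M] {n : ℕ}

/-- The `k`-NN radius `r_k(x) = inf {r : |B(x, r) ∩ X| ≥ k}` for the sample `X = {s 1, …, s n}`.
In the theorem `M` is the subspace `𝒳`, so `Metric.closedBall x r = {x' ∈ 𝒳 : |x - x'| ≤ r}`. -/
noncomputable def kNNRadius (s : Fin n → M) (k : ℕ) (x : M) : ℝ :=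
  sInf {r : ℝ | k ≤ (Metric.closedBall x r ∩ Set.range s).ncard}

/-- The `k`-NN set `N_k(x) = B(x, r_k(x)) ∩ X`. -/
def kNNSet (s : Fin n → M) (k : ℕ) (x : M) : Set M :=
  Metric.closedBall x (kNNRadius s k x) ∩ Set.range s

open Classical in
/-- The `k`-NN regression function `f_k` of the data `(s i, y i)`. -/
noncomputable def kNNRegression (s : Fin n → M) (y : Fin n → ℝ) (k : ℕ) (x : M) : ℝ :=
  1 / ((kNNSet s k x).ncard : ℝ) * ∑ i, y i * (if s i ∈ kNNSet s k x then 1 else 0)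

/-- The pointwise modulus of continuity `u_f(x, r) = sup_{x' ∈ B(x, r)} |f x - f x'|`, with values
in `[0, ∞]` because `f` need not be bounded. -/
noncomputable def modulus (f : M → ℝ) (x : M) (r : ℝ) : ℝ≥0∞ :=
  ⨆ x' ∈ Metric.closedBall x r, ENNReal.ofReal |f x - f x'|

end Estimator

end KNN

/-! The error at `z` splits into bias and averaged noise. Let `R` be the radius in the bound and `a
= γ p₀ v_D`, so that `a * R ^ D = 2k/n` and every ball of radius `R` centred in `𝒳` has mass at
least `2k/n`, twice what `k` sample points require on average.

Bias: a Chernoff bound on slightly smaller balls around a finite net shows that, with probability at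
least `1 - δ/2`, all balls of radius `R` centred in `𝒳` contain `k` sample points
(`measure_exists_card_lt_le`). Then `r_k(z) ≤ R`, and the modulus at `R` bounds the bias without any
regularity of `f`.

Noise: `N_k(z)` is cut out of the sample by a ball. By Radon's theorem balls in `ℝ^D` shatter at
most `D + 1` points, so by Sauer–Shelah at most `n ^ (2D)` index sets arise (`card_ballCuts_le`).
Independence of noise and design permits a union bound over these random sets, with Hoeffding for
each set of size at least `k` (`measure_exists_ballCut_noise_le`).

Sample points are almost surely distinct, so counting points and counting indices agree. -/

namespace KNN

/-! ### Counting the subsets of a finite sample cut out by balls -/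

section Cuts

open Finset

variable {E : Type*} {n : ℕ}

open Classical in
/-- The index sets which some ball cuts out of the points `x i`, with no point on the sphere. -/
noncomputable def ballCuts [PseudoMetricSpace E] (x : Fin n → E) : Finset (Finset (Fin n)) :=
  {S | ∃ (c : E) (r : ℝ), (∀ i ∈ S, dist (x i) c < r) ∧ ∀ i ∉ S, r < dist (x i) c}

theorem mem_ballCuts [PseudoMetricSpace E] {x : Fin n → E} {S : Finset (Fin n)} :
    S ∈ ballCuts x ↔
      ∃ (c : E) (r : ℝ), (∀ i ∈ S, dist (x i) c < r) ∧ ∀ i ∉ S, r < dist (x i) c := by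
  simp [ballCuts]

/-- Strict inequalities on both sides make each condition open, and openness survives the
uncountable union over centres and radii. This supplies measurability of the event that `S` is cut
out. -/
theorem isOpen_setOf_mem_ballCuts [PseudoMetricSpace E] (S : Finset (Fin n)) :
    IsOpen {x : Fin n → E | S ∈ ballCuts x} := by
  have : {x : Fin n → E | S ∈ ballCuts x} = ⋃ (c : E) (r : ℝ),
      (⋂ i ∈ S, {x : Fin n → E | dist (x i) c < r}) ∩
        ⋂ i ∈ Sᶜ, {x : Fin n → E | r < dist (x i) c} := by
    ext x
    simp [mem_ballCuts]
  rw [this]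
  refine isOpen_iUnion fun c => isOpen_iUnion fun r => IsOpen.inter ?_ ?_
  · exact isOpen_biInter_finset fun i _ => isOpen_lt (by fun_prop) continuous_const
  · exact isOpen_biInter_finset fun i _ => isOpen_lt continuous_const (by fun_prop)

open Classical in
/-- The points in a closed ball are cut out by a slightly larger ball. -/
theorem filter_dist_le_mem_ballCuts [PseudoMetricSpace E] (x : Fin n → E) (c : E) (r : ℝ) :
    ({i | dist (x i) c ≤ r} : Finset (Fin n)) ∈ ballCuts x := by
  have hev : ∀ᶠ ρ in nhdsWithin r (Set.Ioi r),
      ∀ i ∈ ({i | dist (x i) c ≤ r} : Finset (Fin n))ᶜ, ρ < dist (x i) c := by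
    rw [Filter.eventually_all_finset]
    intro i hi
    simp only [mem_compl, mem_filter, mem_univ, true_and, not_le] at hi
    exact nhdsWithin_le_nhds (eventually_lt_nhds hi)
  obtain ⟨ρ, hρ, hrρ⟩ := (hev.and self_mem_nhdsWithin).exists
  refine mem_ballCuts.2 ⟨c, ρ, fun i hi => ?_, fun i hi => hρ i (by simpa using hi)⟩
  exact (by simpa using hi : dist (x i) c ≤ r).trans_lt hrρ

variable [NormedAddCommGroup E] [InnerProductSpace ℝ E]

/-- Two balls cannot cut complementary parts out of a set of points when the convex hulls of these
parts intersect. -/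
theorem disjoint_convexHull_of_balls {I J : Set E} {c₁ c₂ : E} {r₁ r₂ : ℝ}
    (hI₁ : ∀ y ∈ I, dist y c₁ < r₁) (hI₂ : ∀ y ∈ I, r₂ < dist y c₂)
    (hJ₁ : ∀ y ∈ J, r₁ < dist y c₁) (hJ₂ : ∀ y ∈ J, dist y c₂ < r₂) :
    Disjoint (convexHull ℝ I) (convexHull ℝ J) := by
  rcases I.eq_empty_or_nonempty with rfl | ⟨a, ha⟩
  · simp
  rcases J.eq_empty_or_nonempty with rfl | ⟨b, hb⟩
  · simp
  -- Nonemptiness makes both radii nonnegative, so the strict inequalities can be squared.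
  have hr₁ : 0 ≤ r₁ := dist_nonneg.trans (hI₁ a ha).le
  have hr₂ : 0 ≤ r₂ := dist_nonneg.trans (hJ₂ b hb).le
  -- The difference of the powers of `y` with respect to the two spheres is affine in `y`; it is
  -- negative on `I` and positive on `J`, so the radical hyperplane separates the hulls.
  set κ : ℝ := r₁ ^ 2 - ‖c₁‖ ^ 2 - (r₂ ^ 2 - ‖c₂‖ ^ 2) with hκ
  have key : ∀ y : E, 2 * inner ℝ (c₂ - c₁) y - κ =
      (dist y c₁ ^ 2 - r₁ ^ 2) - (dist y c₂ ^ 2 - r₂ ^ 2) := by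
    intro y
    rw [dist_eq_norm, dist_eq_norm, norm_sub_sq_real, norm_sub_sq_real, inner_sub_left,
      real_inner_comm y c₁, real_inner_comm y c₂, hκ]
    ring
  have hlin : IsLinearMap ℝ fun y : E => 2 * inner ℝ (c₂ - c₁) y :=
    ⟨fun u v => by rw [inner_add_right]; ring, fun t u => by
      rw [real_inner_smul_right, smul_eq_mul]; ring⟩
  have h₁ : convexHull ℝ I ⊆ {y | 2 * inner ℝ (c₂ - c₁) y < κ} := by
    refine convexHull_min (fun y hy => ?_) (convex_halfSpace_lt hlin κ)
    have e₁ : dist y c₁ ^ 2 < r₁ ^ 2 := pow_lt_pow_left₀ (hI₁ y hy) dist_nonneg two_ne_zero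
    have e₂ : r₂ ^ 2 < dist y c₂ ^ 2 := pow_lt_pow_left₀ (hI₂ y hy) hr₂ two_ne_zero
    have := key y
    rw [Set.mem_ofPred_eq]
    linarith
  have h₂ : convexHull ℝ J ⊆ {y | κ < 2 * inner ℝ (c₂ - c₁) y} := by
    refine convexHull_min (fun y hy => ?_) (convex_halfSpace_gt hlin κ)
    have e₁ : r₁ ^ 2 < dist y c₁ ^ 2 := pow_lt_pow_left₀ (hJ₁ y hy) hr₁ two_ne_zero
    have e₂ : dist y c₂ ^ 2 < r₂ ^ 2 := pow_lt_pow_left₀ (hJ₂ y hy) dist_nonneg two_ne_zero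
    have := key y
    rw [Set.mem_ofPred_eq]
    linarith
  refine Set.disjoint_left.2 fun y hy hy' => ?_
  exact lt_asymm (Set.mem_ofPred.1 (h₁ hy)) (Set.mem_ofPred.1 (h₂ hy'))

/-- A set of indices shattered by balls in a space of dimension `d` has at most `d + 1` elements. -/
theorem card_le_of_shatters_ballCuts [FiniteDimensional ℝ E] {x : Fin n → E} {T : Finset (Fin n)}
    (hT : (ballCuts x).Shatters T) : #T ≤ Module.finrank ℝ E + 1 := by
  classical
  by_contra! hcard
  have hdep : ¬ AffineIndependent ℝ fun i : T => x i := by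
    intro h
    have h1 := h.card_le_finrank_succ
    have h2 := Submodule.finrank_le (vectorSpan ℝ (Set.range fun i : T => x i))
    rw [Fintype.card_coe] at h1
    omega
  -- Shattering would let one ball cut out each half of a Radon partition, whose convex hulls meet.
  obtain ⟨I, hI⟩ := Convex.radon_partition hdep
  obtain ⟨u, hu, huT⟩ := hT (t := ({i | i ∈ I} : Finset T).map (.subtype _))
    (fun i hi => by
      simp only [mem_map, mem_filter, mem_univ, true_and] at hi
      obtain ⟨j, -, rfl⟩ := hi; exact j.2)
  obtain ⟨v, hv, hvT⟩ := hT (t := ({i | i ∉ I} : Finset T).map (.subtype _))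
    (fun i hi => by
      simp only [mem_map, mem_filter, mem_univ, true_and] at hi
      obtain ⟨j, -, rfl⟩ := hi; exact j.2)
  have hu' : ∀ i : T, (i : Fin n) ∈ u ↔ i ∈ I := by
    intro i
    have := Finset.ext_iff.1 huT i
    simpa using this
  have hv' : ∀ i : T, (i : Fin n) ∈ v ↔ i ∉ I := by
    intro i
    have := Finset.ext_iff.1 hvT i
    simpa using this
  obtain ⟨c₁, r₁, h₁, h₁'⟩ := mem_ballCuts.1 hu
  obtain ⟨c₂, r₂, h₂, h₂'⟩ := mem_ballCuts.1 hv
  refine Set.not_disjoint_iff_nonempty_inter.2 hI (disjoint_convexHull_of_balls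
    (c₁ := c₁) (r₁ := r₁) (c₂ := c₂) (r₂ := r₂) ?_ ?_ ?_ ?_)
  · rintro _ ⟨i, hi, rfl⟩; exact h₁ i ((hu' i).2 hi)
  · rintro _ ⟨i, hi, rfl⟩; exact h₂' i fun h => (hv' i).1 h hi
  · rintro _ ⟨i, hi, rfl⟩; exact h₁' i fun h => hi ((hu' i).1 h)
  · rintro _ ⟨i, hi, rfl⟩; exact h₂ i ((hv' i).2 hi)

/-- In the induction both `n ^ d` and the new binomial coefficient are at most half of `n ^ (d +
1)`. The bound fails for `d = 1`, where the sum is `n + 1`. -/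
theorem sum_choose_le_pow {n d : ℕ} (hn : 2 ≤ n) (hd : 2 ≤ d) :
    ∑ i ∈ range (d + 1), n.choose i ≤ n ^ d := by
  induction d, hd using Nat.le_induction with
  | base =>
    have h := Nat.choose_two_right n
    have h2 : n * (n - 1) = n ^ 2 - n := by rw [Nat.mul_sub, mul_one, sq]
    have h3 : 2 * n ≤ n ^ 2 := by nlinarith
    simp only [sum_range_succ, range_zero, sum_empty, Nat.choose_zero_right, Nat.choose_one_right]
    omega
  | succ d hd ih =>
    rw [sum_range_succ]
    have h1 : n.choose (d + 1) * 2 ≤ n ^ (d + 1) := by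
      have h2 := Nat.choose_le_pow_div (α := ℚ) (d + 1) n
      have h3 : (2 : ℚ) ≤ ((d + 1).factorial : ℚ) := by
        have : (2 : ℕ).factorial ≤ (d + 1).factorial := Nat.factorial_le (by omega)
        exact_mod_cast this
      rw [le_div_iff₀ (by positivity)] at h2
      have h4 : (n.choose (d + 1) : ℚ) * 2 ≤ (n : ℚ) ^ (d + 1) :=
        (mul_le_mul_of_nonneg_left h3 (by positivity)).trans h2
      exact_mod_cast h4
    have h2 : n ^ d * 2 ≤ n ^ (d + 1) := by rw [pow_succ]; gcongr
    omega

/-- Sauer–Shelah with VC dimension at most `D + 1`, where `D` is the dimension of `E`; the exponent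
uses `D + 1 ≤ 2D`. -/
theorem card_ballCuts_le [FiniteDimensional ℝ E] (hE : 1 ≤ Module.finrank ℝ E) (hn : 2 ≤ n)
    (x : Fin n → E) : #(ballCuts x) ≤ n ^ (2 * Module.finrank ℝ E) := by
  classical
  have hvc : (ballCuts x).vcDim ≤ Module.finrank ℝ E + 1 :=
    Finset.sup_le fun T hT => card_le_of_shatters_ballCuts (mem_shatterer.1 hT)
  calc #(ballCuts x) ≤ #(ballCuts x).shatterer := card_le_card_shatterer _
    _ ≤ ∑ i ∈ Iic (ballCuts x).vcDim, (Fintype.card (Fin n)).choose i :=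
      card_shatterer_le_sum_vcDim
    _ ≤ ∑ i ∈ range (2 * Module.finrank ℝ E + 1), n.choose i := by
      rw [Fintype.card_fin]
      refine sum_le_sum_of_subset fun i hi => ?_
      simp only [mem_Iic, mem_range] at hi ⊢
      omega
    _ ≤ n ^ (2 * Module.finrank ℝ E) := sum_choose_le_pow hn (by omega)

end Cuts

/-! ### Deterministic analysis of the nearest-neighbour estimator -/

section Radius

variable {M : Type*} [PseudoMetricSpace M] {n : ℕ} {s : Fin n → M} {k : ℕ} {z : M}

theorem kNNRadius_le {r : ℝ} (hk : 1 ≤ k)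
    (hr : k ≤ (Metric.closedBall z r ∩ Set.range s).ncard) : kNNRadius s k z ≤ r := by
  -- Since `k ≥ 1` and balls of negative radius are empty, the set of radii is bounded below by `0`.
  refine csInf_le ⟨0, fun ρ hρ => ?_⟩ hr
  by_contra! hneg
  have : k ≤ 0 := by simpa [Metric.closedBall_eq_empty.2 hneg] using hρ
  omega

/-- The infimum that defines the `k`-NN radius is attained. -/
theorem le_ncard_kNNSet {r : ℝ} (hr : k ≤ (Metric.closedBall z r ∩ Set.range s).ncard) :
    k ≤ (kNNSet s k z).ncard := by
  set R := kNNRadius s k z with hR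
  -- For `ρ` slightly above `R`, no sample point lies at a distance in `(R, ρ]`, so an admissible
  -- radius below `ρ` captures no sample points beyond those within `R`.
  have hev : ∀ᶠ ρ in nhdsWithin R (Set.Ioi R), ∀ i : Fin n, R < dist (s i) z →
      ρ < dist (s i) z := by
    rw [Filter.eventually_all]
    intro i
    by_cases h : R < dist (s i) z
    · filter_upwards [nhdsWithin_le_nhds (eventually_lt_nhds h)] with ρ hρ _ using hρ
    · simp [h]
  obtain ⟨ρ, hρ, hRρ⟩ := (hev.and self_mem_nhdsWithin).exists
  obtain ⟨t, ht, htρ⟩ := exists_lt_of_csInf_lt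
    (s := {r : ℝ | k ≤ (Metric.closedBall z r ∩ Set.range s).ncard}) ⟨r, hr⟩ hRρ
  refine le_trans ht (Set.ncard_le_ncard ?_ ((Set.finite_range s).inter_of_right _))
  rintro _ ⟨hi, i, rfl⟩
  refine ⟨?_, i, rfl⟩
  by_contra h
  rw [Metric.mem_closedBall] at hi h
  exact absurd (hρ i (not_le.1 h)) (not_lt.2 (hi.trans htρ.le))

open Classical in
-- Distinctness turns the cardinality of a set of points into a count of indices, the quantity that
-- the concentration bounds control.
theorem ncard_kNNSet (hs : Function.Injective s) :
    (kNNSet s k z).ncard = (Finset.univ.filter fun i => s i ∈ kNNSet s k z).card := by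
  have : kNNSet s k z = s '' (Finset.univ.filter fun i => s i ∈ kNNSet s k z : Finset (Fin n)) := by
    ext y
    constructor
    · rintro ⟨hy, i, rfl⟩
      exact ⟨i, by simpa using ⟨hy, i, rfl⟩, rfl⟩
    · rintro ⟨i, hi, rfl⟩
      simpa using hi
  conv_lhs => rw [this]
  rw [Set.ncard_image_of_injective _ hs, Set.ncard_coe_finset]

open Classical in
theorem le_ncard_closedBall_inter_range (hs : Function.Injective s) {r : ℝ}
    (h : k ≤ (Finset.univ.filter fun i => dist (s i) z ≤ r).card) :
    k ≤ (Metric.closedBall z r ∩ Set.range s).ncard := by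
  rw [← Set.ncard_coe_finset, ← Set.ncard_image_of_injective _ hs] at h
  refine h.trans (Set.ncard_le_ncard ?_ ((Set.finite_range s).inter_of_right _))
  rintro _ ⟨i, hi, rfl⟩
  exact ⟨by simpa using hi, i, rfl⟩

open Classical in
/-- The bias-variance decomposition: the error of the `k`-NN regression is at most the modulus at
any radius that captures `k` points, plus the averaged noise. -/
theorem ofReal_abs_sub_kNNRegression_le (hs : Function.Injective s) (hk : 1 ≤ k) (f : M → ℝ)
    {y e : Fin n → ℝ} (hy : ∀ i, y i = f (s i) + e i) {r t : ℝ}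
    (hr : k ≤ (Finset.univ.filter fun i => dist (s i) z ≤ r).card)
    (ht : ∀ S : Finset (Fin n), S ∈ ballCuts s → k ≤ S.card → |∑ i ∈ S, e i| ≤ S.card * t) :
    ENNReal.ofReal |f z - kNNRegression s y k z| ≤ modulus f z r + ENNReal.ofReal t := by
  have hr' := le_ncard_closedBall_inter_range hs hr
  set S : Finset (Fin n) := Finset.univ.filter fun i => s i ∈ kNNSet s k z with hS
  have hScuts : S ∈ ballCuts s := by
    convert filter_dist_le_mem_ballCuts s z (kNNRadius s k z) using 2
    simp [kNNSet]
  have hcard : k ≤ S.card := (le_ncard_kNNSet hr').trans_eq (ncard_kNNSet hs)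
  have hpos : (0 : ℝ) < S.card := by exact_mod_cast hk.trans hcard
  have hnoise := ht S hScuts hcard
  have ht0 : 0 ≤ t := by
    by_contra! h
    nlinarith [abs_nonneg (∑ i ∈ S, e i)]
  have hreg : kNNRegression s y k z = 1 / (S.card : ℝ) * ∑ i ∈ S, (f (s i) + e i) := by
    rw [kNNRegression, ncard_kNNSet hs, ← hS]
    congr 1
    simp [hS, Finset.sum_filter, hy]
  rcases eq_or_ne (modulus f z r) ⊤ with htop | htop
  · simp [htop]
  have hbias : ∀ i ∈ S, |f z - f (s i)| ≤ (modulus f z r).toReal := by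
    intro i hi
    have hmem : s i ∈ Metric.closedBall z r := by
      have : s i ∈ kNNSet s k z := by simpa [hS] using hi
      exact Metric.closedBall_subset_closedBall (kNNRadius_le hk hr') this.1
    rw [← ENNReal.ofReal_le_iff_le_toReal htop]
    exact le_iSup₂_of_le (s i) hmem le_rfl
  rw [← ENNReal.ofReal_toReal htop, ← ENNReal.ofReal_add ENNReal.toReal_nonneg ht0]
  refine ENNReal.ofReal_le_ofReal ?_
  have heq : f z - kNNRegression s y k z =
      1 / (S.card : ℝ) * (∑ i ∈ S, (f z - f (s i)) - ∑ i ∈ S, e i) := by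
    rw [hreg, Finset.sum_add_distrib, Finset.sum_sub_distrib, Finset.sum_const, nsmul_eq_mul]
    field_simp
    ring
  have h1 : |∑ i ∈ S, (f z - f (s i))| ≤ S.card * (modulus f z r).toReal := by
    refine (Finset.abs_sum_le_sum_abs _ _).trans ?_
    rw [← nsmul_eq_mul]
    exact Finset.sum_le_card_nsmul _ _ _ hbias
  rw [heq, abs_mul, abs_of_pos (by positivity), one_div, inv_mul_le_iff₀ hpos, mul_add]
  exact (abs_sub _ _).trans (add_le_add h1 hnoise)

end Radius

/-! ### Concentration, nets and uniform noise control -/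

section Probability

variable {Ω : Type*} [MeasurableSpace Ω] {P : Measure Ω} {n : ℕ}

/-- Independent points with diffuse laws are almost surely distinct. -/
theorem ae_injective_of_iIndepFun {E : Type*} [MeasurableSpace E] [MeasurableEq E]
    [MeasurableSingletonClass E]
    [IsProbabilityMeasure P] {x : Fin n → Ω → E} (hx : ∀ i, Measurable (x i))
    (hindep : iIndepFun x P) (hlaw : ∀ i (a : E), P.map (x i) {a} = 0) :
    ∀ᵐ ω ∂P, Function.Injective fun i => x i ω := by
  have hpair : ∀ i j, i ≠ j → ∀ᵐ ω ∂P, x i ω ≠ x j ω := by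
    intro i j hij
    have hprod := (indepFun_iff_map_prod_eq_prod_map_map (hx i).aemeasurable
      (hx j).aemeasurable).1 (hindep.indepFun hij)
    have hdiag : MeasurableSet {z : E × E | z.1 = z.2} := 
      measurableSet_eq_fun measurable_fst measurable_snd
    have : IsProbabilityMeasure (P.map (x i)) := Measure.isProbabilityMeasure_map (hx i).aemeasurable
    have : IsProbabilityMeasure (P.map (x j)) := Measure.isProbabilityMeasure_map (hx j).aemeasurable
    have hnull : (P.map fun ω => (x i ω, x j ω)) {z : E × E | z.1 = z.2} = 0 := by
      rw [hprod, Measure.measure_prod_null hdiag]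
      refine Filter.Eventually.of_forall fun a => ?_
      have : Prod.mk a ⁻¹' {z : E × E | z.1 = z.2} = {a} := by
        ext b; simp [eq_comm]
      change P.map (x j) (Prod.mk a ⁻¹' {z : E × E | z.1 = z.2}) = 0
      rw [this, hlaw]
    rw [Measure.map_apply ((hx i).prodMk (hx j)) hdiag] at hnull
    rw [ae_iff]
    simpa using hnull
  have hall : ∀ᵐ ω ∂P, ∀ i j, i ≠ j → x i ω ≠ x j ω := by
    simp only [ae_all_iff]
    exact hpair
  filter_upwards [hall] with ω hω i j hij
  by_contra h
  exact hω i j h hij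

open Classical in
/-- A Chernoff bound for the lower tail of the number of points in a set. -/
theorem measureReal_card_le_le {E : Type*} [MeasurableSpace E]
    [IsProbabilityMeasure P] {x : Fin n → Ω → E} (hx : ∀ i, Measurable (x i))
    (hindep : iIndepFun x P) {B : Set E} (hB : MeasurableSet B) {q : ℝ}
    (hq : ∀ i, q ≤ P.real (x i ⁻¹' B)) (k : ℕ) :
    P.real {ω | (Finset.univ.filter fun i => x i ω ∈ B).card ≤ k} ≤
      Real.exp (5 / 12 * k - n * q / 3) := by
  set Y : Fin n → Ω → ℝ := fun i ω => B.indicator (fun _ => (1 : ℝ)) (x i ω) with hY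
  have hYm : ∀ i, Measurable (Y i) := fun i => (measurable_const.indicator hB).comp (hx i)
  have hYindep : iIndepFun Y P := hindep.comp (fun _ => B.indicator fun _ => (1 : ℝ))
    fun _ => measurable_const.indicator hB
  -- With `exp t = 2/3` each indicator has moment generating function `1 - P(B)/3 ≤ exp (-q/3)`; the
  -- price `log (3/2)` per counted point is rounded up to `5/12`.
  set t : ℝ := -Real.log (3 / 2) with ht
  have hlog : 0 ≤ Real.log (3 / 2) := Real.log_nonneg (by norm_num)
  have hlog' : Real.log (3 / 2) ≤ 5 / 12 := by
    rw [Real.log_le_iff_le_exp (by norm_num)]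
    have := Real.quadratic_le_exp_of_nonneg (x := 5 / 12) (by norm_num)
    norm_num at this ⊢
    linarith
  have hexp : Real.exp t = 2 / 3 := by
    rw [ht, Real.exp_neg, Real.exp_log (by norm_num)]; norm_num
  have hform : ∀ i ω, Real.exp (t * Y i ω) =
      1 + (x i ⁻¹' B).indicator (fun _ => (-1 / 3 : ℝ)) ω := by
    intro i ω
    by_cases h : x i ω ∈ B
    · simp [hY, h, hexp]; norm_num
    · simp [hY, h]
  have hmgf : ∀ i, mgf (Y i) P t ≤ Real.exp (-q / 3) := by
    intro i
    have hm := hx i hB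
    have : mgf (Y i) P t = 1 - P.real (x i ⁻¹' B) / 3 := by
      simp only [mgf, hform]
      rw [integral_add (integrable_const _) ((integrable_const _).indicator hm),
        integral_indicator_const _ hm]
      simp
      ring
    rw [this]
    have h1 := Real.add_one_le_exp (-q / 3)
    have h2 := hq i
    linarith
  have hsum : ∀ ω, (∑ i, Y i) ω = ((Finset.univ.filter fun i => x i ω ∈ B).card : ℝ) := by
    intro ω
    simp [hY, Set.indicator_apply]
  have hint : Integrable (fun ω => Real.exp (t * (∑ i, Y i) ω)) P := by
    refine Integrable.of_bound (C := 1) (by fun_prop) (Filter.Eventually.of_forall fun ω => ?_)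
    rw [Real.norm_of_nonneg (Real.exp_pos _).le, Real.exp_le_one_iff, hsum, ht]
    have : (0 : ℝ) ≤ ((Finset.univ.filter fun i => x i ω ∈ B).card : ℝ) := by positivity
    nlinarith
  have hset : {ω | (Finset.univ.filter fun i => x i ω ∈ B).card ≤ k} =
      {ω | (∑ i, Y i) ω ≤ (k : ℝ)} := by
    ext ω
    simp only [Set.mem_ofPred_eq, hsum, Nat.cast_le]
  rw [hset]
  calc P.real {ω | (∑ i, Y i) ω ≤ (k : ℝ)}
      ≤ Real.exp (-t * k) * mgf (∑ i, Y i) P t :=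
        measure_le_le_exp_mul_mgf _ (by rw [ht]; linarith) hint
    _ = Real.exp (-t * k) * ∏ i, mgf (Y i) P t := by rw [hYindep.mgf_sum hYm]
    _ ≤ Real.exp (-t * k) * ∏ _i : Fin n, Real.exp (-q / 3) := by
        gcongr with i
        · exact fun i _ => mgf_nonneg
        · exact hmgf i
    _ = Real.exp (-t * k - n * q / 3) := by
        rw [Finset.prod_const, Finset.card_univ, Fintype.card_fin, ← Real.exp_nat_mul,
          ← Real.exp_add]
        congr 1; ring
    _ ≤ Real.exp (5 / 12 * k - n * q / 3) := by
        rw [ht, neg_neg]; gcongr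

/-- A two-sided Hoeffding bound that includes the degenerate case of variance proxy zero. -/
theorem measureReal_lt_abs_sum_le [IsProbabilityMeasure P] {ξ : Fin n → Ω → ℝ}
    (hindep : iIndepFun ξ P) {σ : ℝ≥0} (hξ : ∀ i, HasSubgaussianMGF (ξ i) (σ ^ 2) P)
    {L : ℝ} (hL : 0 ≤ L) {k : ℕ} (hk : 1 ≤ k) {S : Finset (Fin n)} (hS : k ≤ S.card) :
    P.real {ω | S.card * (2 * σ * √(L / k)) < |∑ i ∈ S, ξ i ω|} ≤ 2 * Real.exp (-(2 * L)) := by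
  have hk0 : (0 : ℝ) < k := by exact_mod_cast hk
  have hS0 : (0 : ℝ) < S.card := by exact_mod_cast hk.trans hS
  have hkS : (k : ℝ) ≤ S.card := by exact_mod_cast hS
  rcases eq_or_ne σ 0 with rfl | hσ
  · have h0 : ∀ᵐ ω ∂P, ∀ i, ξ i ω = 0 := ae_all_iff.2 fun i =>
      (HasSubgaussianMGF.ae_eq_zero_of_hasSubgaussianMGF_zero (by simpa using hξ i))
    have : P {ω | S.card * (2 * ((0 : ℝ≥0) : ℝ) * √(L / k)) < |∑ i ∈ S, ξ i ω|} = 0 := by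
      refine measure_mono_null (fun ω hω => ?_) (ae_iff.1 h0)
      intro h
      simp [h] at hω
    rw [measureReal_def, this]
    simp only [ENNReal.toReal_zero]
    positivity
  have hσ0 : (0 : ℝ) < σ := by positivity
  set ε : ℝ := S.card * (2 * σ * √(L / k)) with hε
  have hε0 : 0 ≤ ε := by positivity
  have hsub := HasSubgaussianMGF.sum_of_iIndepFun hindep (s := S) fun i _ => hξ i
  have hbound : Real.exp (-ε ^ 2 / (2 * ((∑ _i ∈ S, σ ^ 2 : ℝ≥0) : ℝ))) ≤
      Real.exp (-(2 * L)) := by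
    rw [Real.exp_le_exp]
    have hsq : ε ^ 2 = S.card ^ 2 * (4 * σ ^ 2 * (L / k)) := by
      rw [hε, mul_pow, mul_pow, mul_pow, Real.sq_sqrt (by positivity)]; ring
    -- The variance proxy of the sum is `|S| σ²`, so the exponent is `-2L |S|/k`, and `|S| ≥ k` only
    -- helps.
    have : -ε ^ 2 / (2 * ((∑ _i ∈ S, σ ^ 2 : ℝ≥0) : ℝ)) = -(2 * L * (S.card / k)) := by
      rw [hsq]
      simp only [Finset.sum_const, nsmul_eq_mul, NNReal.coe_mul, NNReal.coe_natCast,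
        NNReal.coe_pow]
      field_simp
      ring
    rw [this, neg_le_neg_iff]
    have : 1 ≤ (S.card : ℝ) / k := (one_le_div hk0).2 hkS
    nlinarith
  have h1 := (hsub.measure_ge_le hε0).trans hbound
  have h2 := (hsub.neg.measure_ge_le hε0).trans hbound
  calc P.real {ω | ε < |∑ i ∈ S, ξ i ω|}
      ≤ P.real ({ω | ε ≤ ∑ i ∈ S, ξ i ω} ∪ {ω | ε ≤ (-fun ω => ∑ i ∈ S, ξ i ω) ω}) := by
        refine measureReal_mono fun ω hω => ?_
        rcases le_abs'.1 (le_of_lt (Set.mem_ofPred_eq ▸ hω)) with h | h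
        · right
          simp only [Set.mem_ofPred_eq, Pi.neg_apply]
          linarith
        · exact Or.inl h
    _ ≤ _ := (measureReal_union_le _ _).trans (by linarith)

/-- A maximal separated set in a set whose points carry balls of mass at least `m`. -/
theorem exists_finset_cover {E : Type*} [PseudoMetricSpace E] [MeasurableSpace E]
    [OpensMeasurableSpace E] (μ : Measure E) [IsProbabilityMeasure μ] (K : Set E) {ε m : ℝ}
    (hm : 0 < m) (hμ : ∀ z ∈ K, m ≤ μ.real (Metric.closedBall z (ε / 2))) :
    ∃ Z : Finset E, (Z : Set E) ⊆ K ∧ Z.card * m ≤ 1 ∧ ∀ z ∈ K, ∃ c ∈ Z, dist z c ≤ ε := by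
  classical
  let good : Finset E → Prop := fun Z =>
    (Z : Set E) ⊆ K ∧ (Z : Set E).Pairwise fun a b => ε < dist a b
  -- Half-radius balls around separated points are disjoint, so their masses sum to at most one.
  -- This bounds the size of separated sets, and one of maximal size exists.
  have hcard : ∀ Z, good Z → Z.card * m ≤ 1 := by
    intro Z hZ
    have hdisj : (Z : Set E).PairwiseDisjoint fun c => Metric.closedBall c (ε / 2) := by
      intro a ha b hb hab
      refine Metric.closedBall_disjoint_closedBall ?_
      have := hZ.2 ha hb hab
      linarith
    calc (Z.card : ℝ) * m = ∑ _c ∈ Z, m := by simp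
      _ ≤ ∑ c ∈ Z, μ.real (Metric.closedBall c (ε / 2)) :=
        Finset.sum_le_sum fun c hc => hμ c (hZ.1 hc)
      _ = μ.real (⋃ c ∈ Z, Metric.closedBall c (ε / 2)) :=
        (measureReal_biUnion_finset hdisj fun c _ => measurableSet_closedBall).symm
      _ ≤ 1 := measureReal_le_one
  have hbdd : BddAbove {c : ℕ | ∃ Z, good Z ∧ Z.card = c} := by
    refine ⟨⌊1 / m⌋₊, ?_⟩
    rintro _ ⟨Z, hZ, rfl⟩
    exact Nat.le_floor ((le_div_iff₀ hm).2 (hcard Z hZ))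
  obtain ⟨Z, hZ, hZcard⟩ := Nat.sSup_mem (s := {c : ℕ | ∃ Z, good Z ∧ Z.card = c})
    ⟨0, ∅, ⟨by simp, by simp⟩, rfl⟩ hbdd
  refine ⟨Z, hZ.1, hcard Z hZ, fun z hz => ?_⟩
  by_contra! hfar
  -- A point of `Z` covers itself unless `ε < 0`; then its ball is empty, contradicting `m > 0`.
  by_cases hzZ : z ∈ Z
  · have hself := hμ z hz
    have h2 := hfar z hzZ
    rw [dist_self] at h2
    rw [Metric.closedBall_eq_empty.2 (by linarith)] at hself
    simp at hself
    linarith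
  have hins : good (insert z Z) := by
    refine ⟨?_, ?_⟩
    · rw [Finset.coe_insert]; exact Set.insert_subset hz hZ.1
    · rw [Finset.coe_insert]
      refine hZ.2.insert fun b hb _ => ⟨hfar b hb, ?_⟩
      rw [dist_comm]; exact hfar b hb
  have hle := le_csSup hbdd ⟨_, hins, rfl⟩
  rw [Finset.card_insert_of_notMem hzZ, ← hZcard] at hle
  omega

/-- Uniform control of the noise over all index sets cut out of the design points by balls. -/
theorem measure_exists_ballCut_noise_le {E : Type*} [NormedAddCommGroup E] [InnerProductSpace ℝ E]
    [FiniteDimensional ℝ E] [MeasurableSpace E] [BorelSpace E]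
    [IsProbabilityMeasure P] (hE : 1 ≤ Module.finrank ℝ E) (hn : 2 ≤ n)
    {x : Fin n → Ω → E} (hx : ∀ i, Measurable (x i)) {ξ : Fin n → Ω → ℝ}
    (hindep : iIndepFun ξ P)
    (hxξ : IndepFun (fun ω i => x i ω) (fun ω i => ξ i ω) P)
    {σ : ℝ≥0} (hsub : ∀ i, HasSubgaussianMGF (ξ i) (σ ^ 2) P)
    {L : ℝ} (hL : 0 ≤ L) {k : ℕ} (hk : 1 ≤ k) :
    P {ω | ∃ S ∈ ballCuts fun i => x i ω, k ≤ S.card ∧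
        S.card * (2 * σ * √(L / k)) < |∑ i ∈ S, ξ i ω|} ≤
      (n ^ (2 * Module.finrank ℝ E) : ℕ) * ENNReal.ofReal (2 * Real.exp (-(2 * L))) := by
  classical
  have : SecondCountableTopology E := inferInstance
  have hxm : Measurable fun ω i => x i ω := measurable_pi_lambda _ hx
  have hcut : ∀ S : Finset (Fin n), MeasurableSet {z : Fin n → E | S ∈ ballCuts z} := fun S =>
    (isOpen_setOf_mem_ballCuts S).measurableSet
  set q := ENNReal.ofReal (2 * Real.exp (-(2 * L))) with hq
  -- For fixed `S`, the cut event depends only on the design and the deviation only on the noise, so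
  -- the probability factors. Summing over all `S` then gives the expected number of cuts times `q`,
  -- instead of `2 ^ n * q`.
  have hsingle : ∀ S : Finset (Fin n), P {ω | S ∈ ballCuts (fun i => x i ω) ∧ k ≤ S.card ∧
      S.card * (2 * σ * √(L / k)) < |∑ i ∈ S, ξ i ω|} ≤
      P {ω | S ∈ ballCuts fun i => x i ω} * q := by
    intro S
    by_cases hS : k ≤ S.card
    · have hT : MeasurableSet {e : Fin n → ℝ | S.card * (2 * σ * √(L / k)) < |∑ i ∈ S, e i|} :=
        measurableSet_lt measurable_const (by fun_prop)
      have h1 := hxξ.measure_inter_preimage_eq_mul _ _ (hcut S) hT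
      have h2 : P {ω | S.card * (2 * σ * √(L / k)) < |∑ i ∈ S, ξ i ω|} ≤ q := by
        rw [hq, ← ofReal_measureReal]
        exact ENNReal.ofReal_le_ofReal (measureReal_lt_abs_sum_le hindep hsub hL hk hS)
      refine (measure_mono ?_).trans (h1.trans_le (mul_le_mul_right h2 _))
      exact fun ω hω => ⟨hω.1, hω.2.2⟩
    · simp [hS]
  calc P {ω | ∃ S ∈ ballCuts fun i => x i ω, k ≤ S.card ∧
        S.card * (2 * σ * √(L / k)) < |∑ i ∈ S, ξ i ω|}
      ≤ P (⋃ S : Finset (Fin n), {ω | S ∈ ballCuts (fun i => x i ω) ∧ k ≤ S.card ∧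
          S.card * (2 * σ * √(L / k)) < |∑ i ∈ S, ξ i ω|}) := by
        refine measure_mono fun ω hω => ?_
        obtain ⟨S, hS⟩ := hω
        exact Set.mem_iUnion.2 ⟨S, hS⟩
    _ ≤ ∑ S : Finset (Fin n), P {ω | S ∈ ballCuts fun i => x i ω} * q :=
        (measure_iUnion_fintype_le _ _).trans (Finset.sum_le_sum fun S _ => hsingle S)
    _ = (∫⁻ ω, (ballCuts fun i => x i ω).card ∂P) * q := by
        rw [← Finset.sum_mul]
        congr 1
        have : ∀ ω, ((ballCuts fun i => x i ω).card : ℝ≥0∞) = ∑ S : Finset (Fin n),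
            {ω | S ∈ ballCuts fun i => x i ω}.indicator (fun _ => (1 : ℝ≥0∞)) ω := by
          intro ω
          simp [Set.indicator_apply]
        simp_rw [this]
        rw [lintegral_finsetSum _ fun S _ =>
          measurable_const.indicator (s := {ω | S ∈ ballCuts fun i => x i ω}) (hxm (hcut S))]
        refine Finset.sum_congr rfl fun S _ => ?_
        rw [lintegral_indicator_const (s := {ω | S ∈ ballCuts fun i => x i ω}) (hxm (hcut S)),
          one_mul]
    _ ≤ (∫⁻ _ω, (n ^ (2 * Module.finrank ℝ E) : ℕ) ∂P) * q := by
        gcongr with ω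
        exact card_ballCuts_le hE hn _
    _ = _ := by simp

end Probability

/-! ### Uniform lower bound on the number of sample points in a ball -/

section Coverage

variable {E : Type*} [PseudoMetricSpace E] [MeasurableSpace E]

/-- By Bernoulli's inequality `(1 - 1/(4D)) ^ D ≥ 3/4`, so shrinking the radius costs at most a
quarter of the guaranteed mass `2c`. The shrunk radius lies strictly below `r₀` even when `R = r₀`.
-/
theorem le_measureReal_closedBall_of_pow_eq {μ : Measure E} {K : Set E} {D : ℕ} (hD : 1 ≤ D)
    {a r₀ : ℝ} (hμ : ∀ z ∈ K, ∀ r, 0 < r → r < r₀ → a * r ^ D ≤ μ.real (Metric.closedBall z r))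
    {R c : ℝ} (hR : 0 < R) (hRr₀ : R ≤ r₀) (hc : 0 ≤ c) (haR : a * R ^ D = 2 * c) {z : E}
    (hz : z ∈ K) :
    3 / 2 * c ≤ μ.real (Metric.closedBall z ((1 - 1 / (4 * D)) * R)) := by
  have hD' : (1 : ℝ) ≤ D := by exact_mod_cast hD
  have hη : 1 / (4 * (D : ℝ)) ≤ 1 / 4 := one_div_le_one_div_of_le (by norm_num) (by linarith)
  have hη0 : 0 < 1 / (4 * (D : ℝ)) := by positivity
  refine le_trans ?_ (hμ z hz _ (mul_pos (by linarith) hR) (by nlinarith))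
  have hb := one_add_mul_le_pow (a := -(1 / (4 * (D : ℝ)))) (by linarith) D
  have hb' : 3 / 4 ≤ (1 - 1 / (4 * (D : ℝ))) ^ D := by
    refine le_trans (le_of_eq ?_) hb
    field_simp
    norm_num
  rw [mul_pow, mul_left_comm, haR]
  nlinarith

open Classical in
/-- With high probability, every ball of radius `R` around a point of `K` captures at least `k`
design points. -/
theorem measure_exists_card_lt_le [OpensMeasurableSpace E] {Ω : Type*} [MeasurableSpace Ω]
    {P : Measure Ω} [IsProbabilityMeasure P] (μ : Measure E) [IsProbabilityMeasure μ] {K : Set E}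
    {D : ℕ} (hD : 1 ≤ D) {a r₀ : ℝ}
    (hμ : ∀ z ∈ K, ∀ r, 0 < r → r < r₀ → a * r ^ D ≤ μ.real (Metric.closedBall z r))
    {n k : ℕ} (hn : 0 < n) (hk : 1 ≤ k) {R : ℝ} (hR : 0 < R) (hRr₀ : R ≤ r₀)
    (haR : a * R ^ D = 2 * (k / n)) {x : Fin n → Ω → E} (hx : ∀ i, Measurable (x i))
    (hindep : iIndepFun x P) (hlaw : ∀ i, P.map (x i) = μ) :
    P {ω | ∃ z ∈ K, (Finset.univ.filter fun i => dist (x i ω) z ≤ R).card < k} ≤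
      ENNReal.ofReal ((8 * D) ^ D * (n / (2 * k)) * Real.exp (-k / 12)) := by
  have hD' : (1 : ℝ) ≤ D := by exact_mod_cast hD
  have hn' : (0 : ℝ) < n := by exact_mod_cast hn
  have hk' : (0 : ℝ) < k := by exact_mod_cast hk
  -- The guaranteed mass at radius `R/(8D)`, half the net scale `R/(4D)`.
  set m : ℝ := 2 * (k / n) / (8 * D) ^ D with hm
  have hm0 : 0 < m := by positivity
  have hmass : ∀ z ∈ K, m ≤ μ.real (Metric.closedBall z (R / (4 * D) / 2)) := by
    intro z hz
    refine le_trans (le_of_eq ?_) (hμ z hz _ (by positivity) (lt_of_lt_of_le ?_ hRr₀))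
    · rw [hm, ← haR, div_div, div_pow, mul_div_assoc]
      ring_nf
    · rw [div_div, div_lt_iff₀ (by positivity)]
      nlinarith
  obtain ⟨Z, hZK, hZcard, hZcover⟩ := exists_finset_cover μ K hm0 hmass
  -- `ρ` plus the net scale is `R`, so each ball of radius `R` centred in `K` contains a net ball of
  -- radius `ρ`. With `q = (3/2)k/n` the Chernoff exponent is `5k/12 - k/2 = -k/12`.
  set ρ : ℝ := (1 - 1 / (4 * D)) * R with hρ
  have hball : ∀ c ∈ Z, P.real
      {ω | (Finset.univ.filter fun i => x i ω ∈ Metric.closedBall c ρ).card ≤ k} ≤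
      Real.exp (-k / 12) := by
    intro c hc
    refine (measureReal_card_le_le (q := 3 / 2 * (k / n)) hx hindep
      Metric.isClosed_closedBall.measurableSet (fun i => ?_) k).trans (le_of_eq ?_)
    · have := le_measureReal_closedBall_of_pow_eq hD hμ hR hRr₀ (by positivity) haR (hZK hc)
      rwa [← hlaw i, map_measureReal_apply (hx i) Metric.isClosed_closedBall.measurableSet] at this
    · congr 1
      field_simp
      ring
  calc P {ω | ∃ z ∈ K, (Finset.univ.filter fun i => dist (x i ω) z ≤ R).card < k}
      ≤ P (⋃ c ∈ Z,
          {ω | (Finset.univ.filter fun i => x i ω ∈ Metric.closedBall c ρ).card ≤ k}) := by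
        refine measure_mono ?_
        rintro ω ⟨z, hz, hlt⟩
        obtain ⟨c, hc, hzc⟩ := hZcover z hz
        refine Set.mem_biUnion (x := c) hc (le_trans (Finset.card_le_card fun i hi => ?_) hlt.le)
        simp only [Finset.mem_filter, Finset.mem_univ, true_and, Metric.mem_closedBall] at hi ⊢
        calc dist (x i ω) z ≤ dist (x i ω) c + dist z c := dist_triangle_right _ _ _
          _ ≤ ρ + R / (4 * D) := add_le_add hi hzc
          _ = R := by rw [hρ]; ring
    _ ≤ ∑ c ∈ Z, P {ω | (Finset.univ.filter fun i => x i ω ∈ Metric.closedBall c ρ).card ≤ k} :=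
        measure_biUnion_finset_le _ _
    _ ≤ ∑ _c ∈ Z, ENNReal.ofReal (Real.exp (-k / 12)) := by
        refine Finset.sum_le_sum fun c hc => ?_
        rw [← ofReal_measureReal]
        exact ENNReal.ofReal_le_ofReal (hball c hc)
    _ = ENNReal.ofReal (Z.card * Real.exp (-k / 12)) := by
        rw [Finset.sum_const, nsmul_eq_mul, ENNReal.ofReal_mul (by positivity),
          ENNReal.ofReal_natCast]
    _ ≤ _ := by
        refine ENNReal.ofReal_le_ofReal ?_
        gcongr
        rw [← le_div_iff₀ hm0] at hZcard
        refine hZcard.trans (le_of_eq ?_)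
        rw [hm]
        field_simp

end Coverage

/-! ### Mass of balls under the design density -/

section Density

variable {D : ℕ} {p : EuclideanSpace ℝ (Fin D) → ℝ} {𝒳 : Set (EuclideanSpace ℝ (Fin D))}

theorem IsDensityWithSupport.isProbabilityMeasure (hp : IsDensityWithSupport p 𝒳) :
    IsProbabilityMeasure (densityMeasure p) :=
  ⟨by rw [densityMeasure, withDensity_apply _ .univ, Measure.restrict_univ, hp.lintegral_eq_one]⟩

theorem IsDensityWithSupport.densityInf_le (hp : IsDensityWithSupport p 𝒳) {z} (hz : z ∈ 𝒳) :
    densityInf p 𝒳 ≤ p z :=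
  csInf_le ⟨0, by rintro _ ⟨y, -, rfl⟩; exact hp.nonneg y⟩ ⟨z, hz, rfl⟩

theorem IsDensityWithSupport.nonempty (hp : IsDensityWithSupport p 𝒳) : 𝒳.Nonempty := by
  rw [← hp.support_eq, Function.support_nonempty_iff]
  rintro rfl
  simpa using hp.lintegral_eq_one

theorem unitBallVolume_pos (D : ℕ) : 0 < unitBallVolume D :=
  ENNReal.toReal_pos (Metric.measure_closedBall_pos _ _ one_pos).ne' measure_closedBall_lt_top.ne

theorem densityMeasure_singleton (hD : 1 ≤ D) (z : EuclideanSpace ℝ (Fin D)) :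
    densityMeasure p {z} = 0 := by
  have : Nonempty (Fin D) := ⟨⟨0, hD⟩⟩
  exact withDensity_absolutelyContinuous _ _ (measure_singleton z)

/-- Balls around points of the support have mass at least `γ * p₀ * v_D * r ^ D`. -/
theorem IsDensityWithSupport.le_measureReal_closedBall (hp : IsDensityWithSupport p 𝒳)
    (h𝒳 : MeasurableSet 𝒳) (hp₀ : 0 ≤ densityInf p 𝒳) {γ r₀ : ℝ} (hreg : SupportRegular 𝒳 γ r₀)
    {z : EuclideanSpace ℝ (Fin D)} (hz : z ∈ 𝒳) {r : ℝ} (hr : 0 < r) (hr₀ : r < r₀) :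
    γ * densityInf p 𝒳 * unitBallVolume D * r ^ D ≤
      (densityMeasure p).real (Metric.closedBall z r) := by
  have := hp.isProbabilityMeasure
  have hvol : volume (Metric.closedBall z r) =
      ENNReal.ofReal (r ^ D) * ENNReal.ofReal (unitBallVolume D) := by
    rw [Measure.addHaar_closedBall' _ _ hr.le, finrank_euclideanSpace_fin, unitBallVolume,
      ENNReal.ofReal_toReal measure_closedBall_lt_top.ne]
  have hmain : ENNReal.ofReal (densityInf p 𝒳) *
      (ENNReal.ofReal γ * volume (Metric.closedBall z r)) ≤
      densityMeasure p (Metric.closedBall z r) := by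
    calc _ ≤ ENNReal.ofReal (densityInf p 𝒳) * volume (𝒳 ∩ Metric.closedBall z r) := by
          gcongr
          exact hreg.2.2 z hz r hr hr₀
      _ = ∫⁻ _y in 𝒳 ∩ Metric.closedBall z r, ENNReal.ofReal (densityInf p 𝒳) := by
          rw [setLIntegral_const]
      _ ≤ ∫⁻ y in 𝒳 ∩ Metric.closedBall z r, ENNReal.ofReal (p y) :=
          setLIntegral_mono' (h𝒳.inter measurableSet_closedBall) fun y hy =>
            ENNReal.ofReal_le_ofReal (hp.densityInf_le hy.1)
      _ = densityMeasure p (𝒳 ∩ Metric.closedBall z r) := by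
          rw [densityMeasure, withDensity_apply _ (h𝒳.inter measurableSet_closedBall)]
      _ ≤ _ := measure_mono Set.inter_subset_right
  rw [hvol, ← ENNReal.ofReal_mul (by positivity), ← ENNReal.ofReal_mul hreg.1.le,
    ← ENNReal.ofReal_mul hp₀, ← ofReal_measureReal,
    ENNReal.ofReal_le_ofReal_iff measureReal_nonneg] at hmain
  refine le_trans (le_of_eq ?_) hmain
  ring

end Density

/-! ### Choice of constants -/

section Numerics

variable {δ : ℝ} {D n k : ℕ}

/-- The lower bound on `k` gives `k ≥ 128 D`, hence `8D ≤ n`, and the prefactor is at most `n ^ (D +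
1)`. With `L = log (4/δ)`, the exponent `k/12` dominates `(D + 1) log n + L`, which leaves `exp (-L)
= δ/4`. -/
theorem cover_probability_le (hδ₀ : 0 < δ) (hδ₁ : δ < 1) (hD : 1 ≤ D) (hn : 2 ≤ n) (hk : 1 ≤ k)
    (hk_lower : 2 ^ 8 * (D : ℝ) * Real.log (4 / δ) ^ 2 * Real.log n ≤ k)
    (hkn : 3 / 2 * (k : ℝ) ≤ n) :
    (8 * D) ^ D * (n / (2 * k)) * Real.exp (-k / 12) ≤ δ / 2 := by
  set L := Real.log (4 / δ) with hL
  set l := Real.log n with hl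
  have hD' : (1 : ℝ) ≤ D := by exact_mod_cast hD
  have hn' : (2 : ℝ) ≤ n := by exact_mod_cast hn
  have hk' : (1 : ℝ) ≤ k := by exact_mod_cast hk
  have hl2 : 1 / 2 ≤ l :=
    (by linarith [Real.log_two_gt_d9] : 1 / 2 ≤ Real.log 2).trans
      (Real.log_le_log (by norm_num) hn')
  have hL1 : 1 ≤ L := by
    have h4 : Real.log 4 ≤ L := Real.log_le_log (by norm_num) (by
      rw [le_div_iff₀ hδ₀]; linarith)
    have : Real.log 4 = 2 * Real.log 2 := by
      rw [show (4 : ℝ) = 2 ^ 2 by norm_num, Real.log_pow]; norm_num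
    linarith [Real.log_two_gt_d9]
  have hLL : L ≤ L ^ 2 := by nlinarith
  have hDl : (D : ℝ) / 2 ≤ D * l := by nlinarith
  have hDlL : (D : ℝ) * l ≤ D * l * L ^ 2 := le_mul_of_one_le_right (by nlinarith) (by nlinarith)
  have hLDl : L ≤ 2 * (D * l * L ^ 2) := by nlinarith
  have hlow : 256 * (D * l * L ^ 2) ≤ k := by linarith
  have h8 : 8 * (D : ℝ) ≤ n := by linarith
  have hnk : (n : ℝ) / (2 * k) ≤ n := div_le_self (by linarith) (by linarith)
  have hexpL : Real.exp (-L) = δ / 4 := by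
    rw [Real.exp_neg, hL, Real.exp_log (by positivity), inv_div]
  calc (8 * (D : ℝ)) ^ D * (n / (2 * k)) * Real.exp (-k / 12)
      ≤ (n : ℝ) ^ D * n * Real.exp (-k / 12) := by gcongr
    _ = Real.exp ((D + 1) * l + -k / 12) := by
        rw [Real.exp_add, ← pow_succ, ← Real.rpow_natCast, Real.rpow_def_of_pos (by linarith),
          mul_comm (Real.log _), ← hl]
        push_cast
        rfl
    _ ≤ Real.exp (-L) := by
        rw [Real.exp_le_exp]
        nlinarith
    _ ≤ δ / 2 := by rw [hexpL]; linarith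

/-- The factor `exp (-2D log n)` cancels the number of cuts exactly, leaving `2 (δ/2)² = δ²/2`. -/
theorem noise_probability_le (hδ₀ : 0 < δ) (hδ₁ : δ < 1) (hn : 2 ≤ n) :
    (n : ℝ) ^ (2 * D) * (2 * Real.exp (-(2 * (D * Real.log n + Real.log (2 / δ))))) ≤ δ / 2 := by
  have hn0 : (0 : ℝ) < n := by positivity
  have h1 : Real.exp (-(2 * (D * Real.log n + Real.log (2 / δ)))) =
      ((n : ℝ) ^ (2 * D))⁻¹ * (δ / 2) ^ 2 := by
    have e1 : Real.exp (Real.log n * (2 * D : ℕ)) = (n : ℝ) ^ (2 * D) := by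
      rw [← Real.rpow_natCast, Real.rpow_def_of_pos hn0]
    have e2 : Real.exp (-Real.log (2 / δ)) = δ / 2 := by
      rw [Real.exp_neg, Real.exp_log (by positivity), inv_div]
    rw [← e1, ← e2, ← Real.exp_neg, ← Real.exp_nat_mul, ← Real.exp_add]
    congr 1
    push_cast
    ring
  rw [h1]
  have : (n : ℝ) ^ (2 * D) * (2 * (((n : ℝ) ^ (2 * D))⁻¹ * (δ / 2) ^ 2)) = δ ^ 2 / 2 := by
    field_simp
  rw [this]
  nlinarith

end Numerics

end KNN

/-! ### Assembly of the main theorem -/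

theorem theorem1 {Ω : Type*} [MeasurableSpace Ω] (P : Measure Ω) [IsProbabilityMeasure P]
    {D : ℕ} (hD : 1 ≤ D)
    (𝒳 : Set (EuclideanSpace ℝ (Fin D))) (h𝒳 : IsCompact 𝒳)
    -- the regression function: arbitrary, not assumed continuous, bounded or measurable
    (f : 𝒳 → ℝ)
    -- support regularity
    (γ r₀ : ℝ) (hreg : KNN.SupportRegular 𝒳 γ r₀)
    -- the design density, bounded from below on its support
    (p : EuclideanSpace ℝ (Fin D) → ℝ) (hp : KNN.IsDensityWithSupport p 𝒳)
    (hp₀ : 0 < KNN.densityInf p 𝒳)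
    -- the law of the noise: mean zero and sub-Gaussian
    (ν : Measure ℝ) [IsProbabilityMeasure ν] (σ : ℝ≥0) (hν : KNN.SubGaussianNoise ν σ)
    -- the design points are i.i.d. with density `p`
    (n : ℕ) (x : Fin n → Ω → 𝒳) (hx_meas : ∀ i, Measurable (x i)) (hx_indep : iIndepFun x P)
    (hx_law : ∀ i, P.map (fun ω => (x i ω : EuclideanSpace ℝ (Fin D))) = KNN.densityMeasure p)
    -- the noise variables are i.i.d. with law `ν`, and independent of the design points
    (ξ : Fin n → Ω → ℝ) (hξ_meas : ∀ i, Measurable (ξ i)) (hξ_indep : iIndepFun ξ P)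
    (hξ_law : ∀ i, P.map (ξ i) = ν)
    (hxξ_indep : IndepFun (fun ω i => x i ω) (fun ω i => ξ i ω) P)
    -- the observations
    (y : Fin n → Ω → ℝ) (hy : ∀ i ω, y i ω = f (x i ω) + ξ i ω)
    (δ : ℝ) (hδ₀ : 0 < δ) (hδ₁ : δ < 1)
    (k : ℕ) (hk : 1 ≤ k)
    (hk_lower : 2 ^ 8 * (D : ℝ) * Real.log (4 / δ) ^ 2 * Real.log n ≤ k)
    (hk_upper : (k : ℝ) ≤
      1 / 2 * γ * KNN.densityInf p 𝒳 * KNN.unitBallVolume D * r₀ ^ D * n) :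
    ∃ A : Set Ω, MeasurableSet A ∧ ENNReal.ofReal (1 - δ) ≤ P A ∧
      ∀ ω ∈ A, ∀ z : 𝒳,
        ENNReal.ofReal |f z - KNN.kNNRegression (fun i => x i ω) (fun i => y i ω) k z| ≤
          KNN.modulus f z
            ((2 * k / (γ * KNN.densityInf p 𝒳 * KNN.unitBallVolume D * n)) ^ (1 / (D : ℝ)))
          + ENNReal.ofReal
              (2 * σ * Real.sqrt ((D * Real.log n + Real.log (2 / δ)) / k)) := by
  classical
  obtain ⟨hγ, hr₀, -⟩ := id hreg
  have hμprob := hp.isProbabilityMeasure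
  have hv := KNN.unitBallVolume_pos D
  set a : ℝ := γ * KNN.densityInf p 𝒳 * KNN.unitBallVolume D with ha
  have ha0 : 0 < a := by positivity
  have hk0 : (0 : ℝ) < k := by exact_mod_cast hk
  have hn0 : 0 < n := by
    rcases Nat.eq_zero_or_pos n with rfl | h
    · simp only [Nat.cast_zero, mul_zero] at hk_upper
      linarith
    · exact h
  have hn0' : (0 : ℝ) < n := by exact_mod_cast hn0
  have hDne : D ≠ 0 := by omega
  set R : ℝ := (2 * k / (a * n)) ^ (1 / (D : ℝ)) with hRdef
  have hR : 0 < R := by positivity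
  have hRD : R ^ D = 2 * k / (a * n) := by
    rw [hRdef, one_div]
    exact Real.rpow_inv_natCast_pow (by positivity) hDne
  have haR : a * R ^ D = 2 * (k / n) := by
    rw [hRD]
    field_simp
  -- This is the upper bound on `k`, rewritten.
  have hRr₀ : R ≤ r₀ := by
    refine (pow_le_pow_iff_left₀ hR.le hr₀.le hDne).1 ?_
    rw [hRD, div_le_iff₀ (by positivity)]
    have : 1 / 2 * γ * KNN.densityInf p 𝒳 * KNN.unitBallVolume D * r₀ ^ D * n =
        1 / 2 * (r₀ ^ D * (a * n)) := by rw [ha]; ring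
    linarith
  have hmass : ∀ z ∈ 𝒳, ∀ r, 0 < r → r < r₀ →
      a * r ^ D ≤ (KNN.densityMeasure p).real (Metric.closedBall z r) := fun z hz r hr hr' =>
    hp.le_measureReal_closedBall h𝒳.isClosed.measurableSet hp₀.le hreg hz hr hr'
  -- A shrunk ball has mass at least `(3/2)k/n`, and at most one. This also forces `n ≥ 2`, which
  -- the counting and logarithmic estimates need.
  have hkn : 3 / 2 * (k : ℝ) ≤ n := by
    obtain ⟨z, hz⟩ := hp.nonempty
    have h := (KNN.le_measureReal_closedBall_of_pow_eq hD hmass hR hRr₀ (by positivity) haR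
      hz).trans measureReal_le_one
    rwa [← mul_div_assoc, div_le_one hn0'] at h
  have hn2 : 2 ≤ n := by
    have : (1 : ℝ) < n := by
      have : (1 : ℝ) ≤ k := by exact_mod_cast hk
      linarith
    exact_mod_cast this
  let s : Fin n → Ω → EuclideanSpace ℝ (Fin D) := fun i ω => x i ω
  have hs : ∀ i, Measurable (s i) := fun i => measurable_subtype_coe.comp (hx_meas i)
  have hs_indep : iIndepFun s P := hx_indep.comp (fun _ => Subtype.val) fun _ =>
    measurable_subtype_coe
  have hsξ_indep : IndepFun (fun ω i => s i ω) (fun ω i => ξ i ω) P :=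
    hxξ_indep.comp (φ := fun (t : Fin n → 𝒳) i => (t i : EuclideanSpace ℝ (Fin D))) (ψ := id)
      (measurable_pi_lambda _ fun i => measurable_subtype_coe.comp (measurable_pi_apply i))
      measurable_id
  have hsub : ∀ i, HasSubgaussianMGF (ξ i) (σ ^ 2) P := fun i =>
    .of_map (X := fun z : ℝ => z) (hξ_meas i).aemeasurable ((hξ_law i).symm ▸ hν.2)
  set L : ℝ := D * Real.log n + Real.log (2 / δ) with hL
  have hL0 : 0 ≤ L := by
    have h1 : 0 ≤ Real.log (2 / δ) := Real.log_nonneg (by rw [le_div_iff₀ hδ₀]; linarith)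
    have h2 : 0 ≤ Real.log n := Real.log_natCast_nonneg n
    positivity
  set B₁ : Set Ω := {ω | ¬ Function.Injective fun i => s i ω}
  set B₂ : Set Ω :=
    {ω | ∃ z ∈ 𝒳, (Finset.univ.filter fun i => dist (s i ω) z ≤ R).card < k}
  set B₃ : Set Ω := {ω | ∃ S ∈ KNN.ballCuts fun i => s i ω, k ≤ S.card ∧
    S.card * (2 * σ * √(L / k)) < |∑ i ∈ S, ξ i ω|}
  have hB₁ : P B₁ = 0 := ae_iff.1 <| KNN.ae_injective_of_iIndepFun hs hs_indep fun i z => by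
    rw [show P.map (s i) = _ from hx_law i]
    exact KNN.densityMeasure_singleton hD z
  have hB₂ : P B₂ ≤ ENNReal.ofReal (δ / 2) :=
    (KNN.measure_exists_card_lt_le _ hD hmass hn0 hk hR hRr₀ haR hs hs_indep hx_law).trans
      (ENNReal.ofReal_le_ofReal (KNN.cover_probability_le hδ₀ hδ₁ hD hn2 hk hk_lower hkn))
  have hB₃ : P B₃ ≤ ENNReal.ofReal (δ / 2) := by
    refine (KNN.measure_exists_ballCut_noise_le (by simpa using hD) hn2 hs hξ_indep hsξ_indep
      hsub hL0 hk).trans ?_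
    rw [← ENNReal.ofReal_natCast, ← ENNReal.ofReal_mul (by positivity), finrank_euclideanSpace_fin]
    refine ENNReal.ofReal_le_ofReal ?_
    push_cast
    exact KNN.noise_probability_le hδ₀ hδ₁ hn2
  have hbad : P (B₁ ∪ B₂ ∪ B₃) ≤ ENNReal.ofReal δ := by
    calc P (B₁ ∪ B₂ ∪ B₃) ≤ P B₁ + P B₂ + P B₃ :=
          (measure_union_le _ _).trans (by gcongr; exact measure_union_le _ _)
      _ ≤ 0 + ENNReal.ofReal (δ / 2) + ENNReal.ofReal (δ / 2) := by
          rw [hB₁]; gcongr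
      _ = ENNReal.ofReal δ := by
          rw [zero_add, ← ENNReal.ofReal_add (by positivity) (by positivity), add_halves]
  -- The bad set involves uncountably many `z`; its measurable hull has the same measure, so
  -- measurability need not be proved.
  refine ⟨(toMeasurable P (B₁ ∪ B₂ ∪ B₃))ᶜ, (measurableSet_toMeasurable _ _).compl, ?_, ?_⟩
  · rw [prob_compl_eq_one_sub (measurableSet_toMeasurable _ _), measure_toMeasurable,
      ENNReal.ofReal_sub _ hδ₀.le, ENNReal.ofReal_one]
    exact tsub_le_tsub_left hbad 1
  intro ω hω z
  have hω' : ω ∉ B₁ ∪ B₂ ∪ B₃ := fun h => hω (subset_toMeasurable _ _ h)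
  simp only [Set.mem_union, not_or] at hω'
  obtain ⟨⟨h₁, h₂⟩, h₃⟩ := hω'
  have hinj : Function.Injective fun i => x i ω := by
    have : Function.Injective fun i => s i ω := not_not.1 h₁
    exact fun i j hij => this (congrArg Subtype.val hij)
  refine KNN.ofReal_abs_sub_kNNRegression_le hinj hk f (fun i => hy i ω) ?_ ?_
  · by_contra! h
    exact h₂ ⟨z, z.2, h⟩
  · intro S hS hkS
    -- A cut by a ball of the subspace `𝒳` is also a cut by the ambient ball with the same centre
    -- and radius, because the distances agree.
    obtain ⟨c, r, hc⟩ := KNN.mem_ballCuts.1 hS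
    by_contra! h
    exact h₃ ⟨S, KNN.mem_ballCuts.2 ⟨c, r, hc⟩, hkS, h⟩
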